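/- Let $\mathcal{A}=\mathbb{Z}[q,q^{-1}]\subset\mathbb{Q}(q)$, where $q$ is an indeterminate. Let $U_q(\mathfrak{sl}_2)$ be the unital associative $\mathbb{Q}(q)$-algebra with generators $E,F,K,K^{-1}$ and relations $KK^{-1}=K^{-1}K=1$, $KEK^{-1}=q^2E$, $KFK^{-1}=q^{-2}F$, $EF-FE=\frac{K-K^{-1}}{q-q^{-1}}$. For $n,t\in\mathbb{N}_0$ and $a,c\in\mathbb{Z}$ put $\{n\}_q=\frac{q^n-q^{-n}}{q-q^{-1}}$, $\{n\}_q!=\{n\}_q\{n-1\}_q\cdots\{1\}_q$, $E^{(n)}=E^n/\{n\}_q!$, $F^{(n)}=F^n/\{n\}_q!$, $[K;a]=\frac{q^aK-q^{-a}K^{-1}}{q-q^{-1}}$ and $$\begin{bmatrix}K;c\\t\end{bmatrix}=\frac{[K;c][K;c-1]\cdots[K;c-t+1]}{\{t\}_q!}.$$ Let $U_{\mathcal{A}}(\mathfrak{sl}_2)$ be the $\mathcal{A}$-subalgebra of $U_q(\mathfrak{sl}_2)$ generated by $K$, $K^{-1}$ and all $E^{(n)}$, $F^{(n)}$, $\begin{bmatrix}K;0\\t\end{bmatrix}$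 ($n,t\ge 0$), and let $U^0_{\mathcal{A}}(\mathfrak{sl}_2)$ be the $\mathcal{A}$-subalgebra generated by $K$, $K^{-1}$ and all $\begin{bmatrix}K;0\\t\end{bmatrix}$ ($t\ge 0$). Then: (1) The elements $\begin{bmatrix}K;0\\t\end{bmatrix}$ for $t\ge 0$ together with the elements $\begin{bmatrix}K;1\\t\end{bmatrix}$ for $t\ge 1$ form an $\mathcal{A}$-basis of $U^0_{\mathcal{A}}(\mathfrak{sl}_2)$. (2) The elements $F^{(a)}\begin{bmatrix}K;c\\t\end{bmatrix}E^{(b)}$ for $a,b,t\in\mathbb{N}_0$ and $c\in\{0,\min(1,t)\}$ form an $\mathcal{A}$-basis of $U_{\mathcal{A}}(\mathfrak{sl}_2)$. -/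

import Mathlib

noncomputable section

namespace QuantumSl2

/-- The field `ℚ(q)` of rational functions in one indeterminate. -/
abbrev Qq : Type := RatFunc ℚ

/-- The indeterminate `q` of `ℚ(q)`. -/
def q : Qq := RatFunc.X

/-- The ring `𝒜 = ℤ[q, q⁻¹]`, as a subring of `ℚ(q)`. -/
abbrev laurentRing : Subalgebra ℤ Qq := Algebra.adjoin ℤ {q, q⁻¹}

/-- The quantum integer `{n}_q = (q^n - q^{-n}) / (q - q⁻¹)`. -/
def qInt (n : ℕ) : Qq := (q ^ (n : ℤ) - q ^ (-(n : ℤ))) / (q - q⁻¹)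

/-- The quantum factorial `{n}_q! = {n}_q {n-1}_q ⋯ {1}_q`. -/
def qFactorial (n : ℕ) : Qq := ∏ i ∈ Finset.range n, qInt (i + 1)

/-- The four generators of the quantum group. -/
inductive Gen : Type
  | E
  | F
  | K
  | Kinv

/-- A generator as an element of the free algebra. -/
abbrev gen (x : Gen) : FreeAlgebra Qq Gen := FreeAlgebra.ι Qq x

/-- The defining relations of `U_q(sl₂)`. -/
inductive Rel : FreeAlgebra Qq Gen → FreeAlgebra Qq Gen → Prop
  | K_Kinv : Rel (gen .K * gen .Kinv) 1
  | Kinv_K : Rel (gen .Kinv * gen .K) 1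
  | K_E : Rel (gen .K * gen .E * gen .Kinv) (q ^ 2 • gen .E)
  | K_F : Rel (gen .K * gen .F * gen .Kinv) ((q ^ 2)⁻¹ • gen .F)
  | E_F : Rel (gen .E * gen .F - gen .F * gen .E) ((q - q⁻¹)⁻¹ • (gen .K - gen .Kinv))

/-- The quantum group `U_q(sl₂)`: the unital associative `ℚ(q)`-algebra on the generators
`E, F, K, K⁻¹` subject to the defining relations. -/
def Uq : Type := RingQuot Rel

instance : Ring Uq := inferInstanceAs (Ring (RingQuot Rel))

instance : Algebra Qq Uq := inferInstanceAs (Algebra Qq (RingQuot Rel))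

/-- The quotient map from the free algebra. -/
def mk : FreeAlgebra Qq Gen →ₐ[Qq] Uq := RingQuot.mkAlgHom Qq Rel

/-- The generator `E` of `U_q(sl₂)`. -/
def E : Uq := mk (gen .E)

/-- The generator `F` of `U_q(sl₂)`. -/
def F : Uq := mk (gen .F)

/-- The generator `K` of `U_q(sl₂)`. -/
def K : Uq := mk (gen .K)

/-- The generator `K⁻¹` of `U_q(sl₂)`. -/
def Kinv : Uq := mk (gen .Kinv)

/-- The divided power `E^{(n)} = E^n / {n}_q!`. -/
def dividedE (n : ℕ) : Uq := (qFactorial n)⁻¹ • E ^ n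

/-- The divided power `F^{(n)} = F^n / {n}_q!`. -/
def dividedF (n : ℕ) : Uq := (qFactorial n)⁻¹ • F ^ n

/-- `[K; a] = (q^a K - q^{-a} K⁻¹) / (q - q⁻¹)`. -/
def bracketK (a : ℤ) : Uq := (q - q⁻¹)⁻¹ • (q ^ a • K - q ^ (-a) • Kinv)

/-- Lusztig's element `[K; c choose t] = [K; c] [K; c-1] ⋯ [K; c-t+1] / {t}_q!`. -/
def lusztig (c : ℤ) (t : ℕ) : Uq :=
  (qFactorial t)⁻¹ • ((List.range t).map fun i => bracketK (c - (i : ℤ))).prod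

/-- Lusztig's integral form `U_𝒜(sl₂)`: the `𝒜`-subalgebra of `U_q(sl₂)` generated by the divided
powers `E^{(n)}`, `F^{(n)}`, by `K`, `K⁻¹` and by the elements `[K; 0 choose t]`. -/
def integralForm : Subalgebra laurentRing Uq :=
  Algebra.adjoin laurentRing
    (Set.range dividedE ∪ Set.range dividedF ∪ {K, Kinv} ∪ Set.range (lusztig 0))

/-- The Cartan part `U⁰_𝒜(sl₂)` of Lusztig's integral form: the `𝒜`-subalgebra generated by `K`,
`K⁻¹` and the elements `[K; 0 choose t]`. -/
def integralCartan : Subalgebra laurentRing Uq :=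
  Algebra.adjoin laurentRing ({K, Kinv} ∪ Set.range (lusztig 0))

/-- The indices `(c, t)` with `c = 0` and `t ≥ 0`, or `c = 1` and `t ≥ 1`. -/
abbrev CartanIndex : Type := {p : ℤ × ℕ // p.1 = 0 ∨ (p.1 = 1 ∧ 1 ≤ p.2)}

/-- The indices `(a, c, t, b)` with `a, t, b ≥ 0` and `c ∈ {0, min(1, t)}`. -/
abbrev FullIndex : Type := {p : ℕ × ℤ × ℕ × ℕ // p.2.1 = 0 ∨ p.2.1 = min 1 (p.2.2.1 : ℤ)}

end QuantumSl2

end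

/-!
Both bases are obtained by spanning over `𝒜` together with linear independence over `ℚ(q)`.

For the Cartan part, let `M_c` be the `𝒜`-span of the elements `[K; c choose t]` and
`K⁻¹ [K; c choose t]`. The relation `[K; c - t] [K; c choose t] = {t+1} [K; c choose t+1]` makes it
stable under `K` and `K⁻¹`, and Pascal's rule `lusztig_pascal` then shows that `M_c` does not depend
on `c`. Since `[K; 0 choose t] [K; -t choose j]` is the Gaussian binomial `{t+j}! / ({t}! {j}!)`
times `[K; 0 choose t+j]`, expanding an element of `M_0 = M_{-t}` in terms of `M_{-t}` shows that
`M_0` is stable under `[K; 0 choose t]`; hence it is the whole Cartan part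
(`mem_integralCartan_iff`). Pascal's rule at `c = 0` trades `K⁻¹ [K; 0 choose t]` for
`[K; 1 choose t+1]`, up to a power of `q`.

For the full integral form, the span of the products `F^{(a)} u E^{(b)}` with `u` in the Cartan part
is stable under left multiplication by all generators. The case of `E^{(n)}` rests on Kac's formula
`dividedE_mul_dividedFZ`, whose coefficients are again of the form `[K; c choose t]`.

Linear independence comes from the regular representation, written down explicitly in the
coordinates `F^a K^n E^b` (`rep`); checking the defining relations there replaces the
Poincaré–Birkhoff–Witt theorem. Applied to the coordinates of `1`, it recovers the coefficients of
`F^{(a)} [K; c choose t] E^{(b)}`. As a Laurent polynomial in `K`, `[K; c choose t]` is supported in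
degrees `-t, …, t`, and its extreme coefficients scale with `c` as `q^{ct}` and `q^{-ct}`, so that
for `t ≥ 1` the extreme coefficients of `[K; 0 choose t]` and `[K; 1 choose t]` form an invertible
`2 × 2` matrix; the family is block triangular with respect to `t`.
-/

noncomputable section

namespace QuantumSl2

/-! ### Quantum integers and binomials -/

lemma q_ne_zero : q ≠ 0 := RatFunc.X_ne_zero

lemma q_pow_ne_one {n : ℕ} (hn : n ≠ 0) : q ^ n ≠ 1 := by
  intro h
  have h' : algebraMap (Polynomial ℚ) Qq (Polynomial.X ^ n) = algebraMap (Polynomial ℚ) Qq 1 := by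
    simpa [q] using h
  have h2 := congrArg Polynomial.natDegree (RatFunc.algebraMap_injective ℚ h')
  simp at h2
  exact hn h2

lemma q_zpow_ne_one {n : ℤ} (hn : n ≠ 0) : q ^ n ≠ 1 := by
  obtain ⟨m, rfl | rfl⟩ := n.eq_nat_or_neg
  · rw [zpow_natCast]
    exact q_pow_ne_one (by simpa using hn)
  · rw [zpow_neg, zpow_natCast, inv_ne_one]
    exact q_pow_ne_one (by simpa using hn)

lemma q_zpow_sub_zpow_neg_ne_zero {n : ℤ} (hn : n ≠ 0) : q ^ n - q ^ (-n) ≠ 0 := by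
  intro h
  refine q_zpow_ne_one (n := n + n) (by lia) ?_
  rw [zpow_add₀ q_ne_zero]
  nth_rewrite 1 [sub_eq_zero.mp h]
  rw [← zpow_add₀ q_ne_zero, neg_add_cancel, zpow_zero]

lemma q_sub_inv_ne_zero : q - q⁻¹ ≠ 0 := by
  simpa using q_zpow_sub_zpow_neg_ne_zero (n := 1) one_ne_zero

/-- The quantum integer `{m}_q`, extended to all integers `m`. -/
def qIntZ (m : ℤ) : Qq := (q ^ m - q ^ (-m)) / (q - q⁻¹)

lemma qInt_eq_qIntZ (n : ℕ) : qInt n = qIntZ n := rfl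

@[simp] lemma qIntZ_zero : qIntZ 0 = 0 := by simp [qIntZ]

@[simp] lemma qIntZ_one : qIntZ 1 = 1 := by simp [qIntZ, q_sub_inv_ne_zero]

lemma qIntZ_ne_zero {m : ℤ} (hm : m ≠ 0) : qIntZ m ≠ 0 :=
  div_ne_zero (q_zpow_sub_zpow_neg_ne_zero hm) q_sub_inv_ne_zero

lemma qIntZ_mul (m : ℤ) : qIntZ m * (q - q⁻¹) = q ^ m - q ^ (-m) :=
  div_mul_cancel₀ _ q_sub_inv_ne_zero

lemma qIntZ_add (m n : ℤ) : qIntZ (m + n) = q ^ n * qIntZ m + q ^ (-m) * qIntZ n := by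
  simp only [qIntZ, neg_add, zpow_add₀ q_ne_zero, zpow_neg]
  field_simp [q_ne_zero, q_sub_inv_ne_zero]
  ring

@[simp] lemma qFactorial_zero : qFactorial 0 = 1 := by simp [qFactorial]

lemma qFactorial_succ (n : ℕ) : qFactorial (n + 1) = qFactorial n * qIntZ (n + 1) := by
  simp [qFactorial, Finset.prod_range_succ, qInt_eq_qIntZ]

lemma qFactorial_ne_zero (n : ℕ) : qFactorial n ≠ 0 := by
  induction n with
  | zero => simp
  | succ n ih =>
    rw [qFactorial_succ]
    exact mul_ne_zero ih (qIntZ_ne_zero (by lia))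

/-- The Gaussian binomial coefficient `{m+n}! / ({m}! {n}!)`. -/
def qBinom (m n : ℕ) : Qq := qFactorial (m + n) / (qFactorial m * qFactorial n)

lemma qBinom_succ_succ (m n : ℕ) : qBinom (m + 1) (n + 1) =
    q ^ ((n : ℤ) + 1) * qBinom m (n + 1) + q ^ (-((m : ℤ) + 1)) * qBinom (m + 1) n := by
  have h := qIntZ_add (m + 1) (n + 1)
  have hm := qFactorial_ne_zero m
  have hn := qFactorial_ne_zero n
  have hm' : qIntZ (m + 1) ≠ 0 := qIntZ_ne_zero (by lia)
  have hn' : qIntZ (n + 1) ≠ 0 := qIntZ_ne_zero (by lia)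
  have e1 : qFactorial (m + 1 + (n + 1)) = qFactorial (m + n + 1) * qIntZ (m + 1 + (n + 1)) := by
    rw [show m + 1 + (n + 1) = (m + n + 1) + 1 by ring, qFactorial_succ]
    congr 2; push_cast; ring
  simp only [qBinom]
  rw [e1, h, show m + (n + 1) = m + n + 1 by ring, show m + 1 + n = m + n + 1 by ring,
    qFactorial_succ m, qFactorial_succ n]
  field_simp

lemma q_zpow_mem (n : ℤ) : q ^ n ∈ laurentRing := by
  obtain ⟨m, rfl | rfl⟩ := n.eq_nat_or_neg
  · rw [zpow_natCast]
    exact pow_mem (Algebra.subset_adjoin (by simp)) m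
  · rw [zpow_neg, zpow_natCast, ← inv_pow]
    exact pow_mem (Algebra.subset_adjoin (by simp)) m

lemma qBinom_mem (m n : ℕ) : qBinom m n ∈ laurentRing := by
  induction m generalizing n with
  | zero =>
    have : qBinom 0 n = 1 := by simp [qBinom, qFactorial_ne_zero]
    rw [this]; exact one_mem _
  | succ m ihm =>
    induction n with
    | zero =>
      have : qBinom (m + 1) 0 = 1 := by simp [qBinom, qFactorial_ne_zero]
      rw [this]; exact one_mem _
    | succ n ihn =>
      rw [qBinom_succ_succ]
      exact add_mem (mul_mem (q_zpow_mem _) (ihm _)) (mul_mem (q_zpow_mem _) ihn)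

lemma smul_mem_of_mem_laurentRing {S : Submodule laurentRing Uq} {c : Qq} (hc : c ∈ laurentRing)
    {x : Uq} (hx : x ∈ S) : c • x ∈ S :=
  S.smul_mem (⟨c, hc⟩ : laurentRing) hx

/-! ### Commutation relations -/

lemma mk_eq_of_rel {x y : FreeAlgebra Qq Gen} (h : Rel x y) : mk x = mk y :=
  RingQuot.mkAlgHom_rel Qq h

lemma K_mul_Kinv : K * Kinv = 1 := by
  simpa [K, Kinv] using mk_eq_of_rel Rel.K_Kinv

lemma Kinv_mul_K : Kinv * K = 1 := by
  simpa [K, Kinv] using mk_eq_of_rel Rel.Kinv_K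

lemma K_mul_E : K * E = q ^ (2 : ℤ) • (E * K) := by
  have h : K * E * Kinv = q ^ 2 • E := by
    simpa [K, Kinv, E] using mk_eq_of_rel Rel.K_E
  calc K * E = (K * E * Kinv) * K := by rw [mul_assoc _ Kinv, Kinv_mul_K, mul_one]
    _ = _ := by rw [h, smul_mul_assoc]; norm_cast

lemma K_mul_F : K * F = q ^ (-2 : ℤ) • (F * K) := by
  have h : K * F * Kinv = (q ^ 2)⁻¹ • F := by
    simpa [K, Kinv, F] using mk_eq_of_rel Rel.K_F
  calc K * F = (K * F * Kinv) * K := by rw [mul_assoc _ Kinv, Kinv_mul_K, mul_one]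
    _ = _ := by rw [h, smul_mul_assoc, zpow_neg]; norm_cast

lemma Kinv_mul_of_K_mul {x : Uq} {m : ℤ} (h : K * x = q ^ m • (x * K)) :
    Kinv * x = q ^ (-m) • (x * Kinv) := by
  have h2 : x * Kinv = q ^ m • (Kinv * x) := by
    calc x * Kinv = Kinv * (K * x) * Kinv := by rw [← mul_assoc, Kinv_mul_K, one_mul]
      _ = q ^ m • (Kinv * x * (K * Kinv)) := by
        rw [h, mul_smul_comm, smul_mul_assoc]; simp only [mul_assoc]
      _ = _ := by rw [K_mul_Kinv, mul_one]
  rw [h2, smul_smul, ← zpow_add₀ q_ne_zero, neg_add_cancel, zpow_zero, one_smul]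

lemma E_mul_F : E * F = F * E + bracketK 0 := by
  have h : E * F - F * E = (q - q⁻¹)⁻¹ • (K - Kinv) := by
    simpa [K, Kinv, E, F, smul_sub] using mk_eq_of_rel Rel.E_F
  rw [bracketK, ← sub_eq_iff_eq_add', h]
  simp

lemma K_mul_pow_of_K_mul {x : Uq} {m : ℤ} (h : K * x = q ^ m • (x * K)) (n : ℕ) :
    K * x ^ n = q ^ (m * n) • (x ^ n * K) := by
  induction n with
  | zero => simp
  | succ n ih =>
    rw [pow_succ, ← mul_assoc, ih, smul_mul_assoc, mul_assoc, h, mul_smul_comm, smul_smul,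
      ← zpow_add₀ q_ne_zero, ← mul_assoc]
    congr 2; push_cast; ring

lemma bracketK_mul_of_K_mul {x : Uq} {m : ℤ} (h : K * x = q ^ m • (x * K)) (c : ℤ) :
    bracketK c * x = x * bracketK (c + m) := by
  simp only [bracketK, smul_mul_assoc, mul_smul_comm, sub_mul, mul_sub, h, Kinv_mul_of_K_mul h,
    smul_smul, ← zpow_add₀ q_ne_zero]
  congr 4; ring

lemma commute_K_bracketK (c : ℤ) : Commute K (bracketK c) := by
  have : Commute K Kinv := K_mul_Kinv.trans Kinv_mul_K.symm
  exact Commute.smul_right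
    (Commute.sub_right ((Commute.refl K).smul_right _) (this.smul_right _)) _

lemma commute_Kinv_bracketK (c : ℤ) : Commute Kinv (bracketK c) := by
  have : Commute Kinv K := Kinv_mul_K.trans K_mul_Kinv.symm
  exact Commute.smul_right
    (Commute.sub_right (this.smul_right _) ((Commute.refl Kinv).smul_right _)) _

lemma commute_bracketK (c d : ℤ) : Commute (bracketK c) (bracketK d) :=
  Commute.smul_left (Commute.sub_left ((commute_K_bracketK d).smul_left _)
    ((commute_Kinv_bracketK d).smul_left _)) _

@[simp] lemma lusztig_zero (c : ℤ) : lusztig c 0 = 1 := by simp [lusztig]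

lemma lusztig_eq_map (c : ℤ) (t : ℕ) : lusztig c t =
    (qFactorial t)⁻¹ • ((List.range t).map fun i : ℕ => bracketK (c - (i : ℤ))).prod := by
  simp [lusztig, ← List.map_eq_flatMap, Function.comp_def]

lemma lusztig_succ (c : ℤ) (t : ℕ) :
    lusztig c (t + 1) = (qIntZ (t + 1))⁻¹ • (lusztig c t * bracketK (c - t)) := by
  simp only [lusztig_eq_map, List.range_succ, List.map_append, List.prod_append, List.map_cons,
    List.map_nil, List.prod_cons, List.prod_nil, mul_one, smul_mul_assoc, smul_smul,
    qFactorial_succ, mul_inv_rev]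

lemma lusztig_succ' (c : ℤ) (t : ℕ) :
    lusztig (c + 1) (t + 1) = (qIntZ (t + 1))⁻¹ • (bracketK (c + 1) * lusztig c t) := by
  simp only [lusztig_eq_map, List.range_succ_eq_map, List.map_cons, List.map_map, List.prod_cons,
    mul_smul_comm, smul_smul, qFactorial_succ, mul_inv_rev]
  have h : (List.range t).map ((fun i : ℕ => bracketK (c + 1 - i)) ∘ Nat.succ) =
      (List.range t).map fun i : ℕ => bracketK (c - i) := by
    refine List.map_congr_left fun i _ => ?_
    simp only [Function.comp]
    congr 1; push_cast; ring
  simp [h]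

lemma commute_lusztig {x : Uq} (h : ∀ c, Commute x (bracketK c)) (c : ℤ) (t : ℕ) :
    Commute x (lusztig c t) := by
  induction t with
  | zero => simp
  | succ t ih => rw [lusztig_succ]; exact (ih.mul_right (h _)).smul_right _

lemma lusztig_mul_of_K_mul {x : Uq} {m : ℤ} (h : K * x = q ^ m • (x * K)) (c : ℤ) (t : ℕ) :
    lusztig c t * x = x * lusztig (c + m) t := by
  induction t with
  | zero => simp
  | succ t ih =>
    rw [lusztig_succ, lusztig_succ, smul_mul_assoc, mul_assoc, bracketK_mul_of_K_mul h,
      ← mul_assoc, ih, mul_smul_comm, mul_assoc, show c - t + m = c + m - t by ring]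

lemma bracketK_mul_lusztig (c : ℤ) (t : ℕ) :
    bracketK (c - t) * lusztig c t = qIntZ (t + 1) • lusztig c (t + 1) := by
  rw [lusztig_succ, smul_smul, mul_inv_cancel₀ (qIntZ_ne_zero (by lia)), one_smul]
  exact commute_lusztig (commute_bracketK _) _ _

/-- The analogue of Pascal's rule for the elements `[K; c choose t]`. -/
lemma lusztig_pascal (c : ℤ) (t : ℕ) : lusztig (c + 1) (t + 1) =
    q ^ ((t : ℤ) + 1) • lusztig c (t + 1) + q ^ ((t : ℤ) - c) • (Kinv * lusztig c t) := by
  have key : bracketK (c + 1) = q ^ ((t : ℤ) + 1) • bracketK (c - t) +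
      (qIntZ (t + 1) * q ^ ((t : ℤ) - c)) • Kinv := by
    simp only [bracketK, smul_sub, smul_smul]
    rw [sub_add_eq_add_sub, add_sub_assoc, ← sub_smul, sub_eq_add_neg, ← neg_smul]
    congr 2
    · rw [mul_left_comm, ← zpow_add₀ q_ne_zero]; congr 2; ring
    · rw [qIntZ, div_eq_mul_inv, mul_comm _ (q - q⁻¹)⁻¹, mul_assoc, sub_mul,
        mul_left_comm (q ^ _), ← mul_sub, ← zpow_add₀ q_ne_zero, ← zpow_add₀ q_ne_zero,
        ← zpow_add₀ q_ne_zero, ← mul_neg, neg_eq_iff_eq_neg.mpr]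
      rw [show (t : ℤ) + 1 + -(c - t) = t + 1 + (t - c) by ring,
        show -((t : ℤ) + 1) + (t - c) = -(c + 1) by ring]
      ring
  have h0 : qIntZ ((t : ℤ) + 1) ≠ 0 := qIntZ_ne_zero (by lia)
  rw [lusztig_succ', key, add_mul, smul_mul_assoc, bracketK_mul_lusztig, smul_mul_assoc, smul_add,
    smul_smul, smul_smul, smul_smul]
  congr 2 <;> field_simp

/-! ### The Cartan part -/

/-- A submodule that contains `1` and is stable under left multiplication by a set of elements
contains the subalgebra which that set generates. -/
lemma mem_of_mem_adjoin_of_mul_mem {S : Submodule laurentRing Uq} {G : Set Uq} (h1 : 1 ∈ S)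
    (hG : ∀ g ∈ G, ∀ x ∈ S, g * x ∈ S) {x : Uq} (hx : x ∈ Algebra.adjoin laurentRing G) :
    x ∈ S := by
  have hx' : x ∈ Submodule.span laurentRing (Submonoid.closure G : Set Uq) := by
    rw [← Algebra.adjoin_eq_span]; exact hx
  refine (Submodule.span_le.mpr fun y hy => ?_) hx'
  induction hy using Submonoid.closure_induction_left with
  | one => exact h1
  | mul_left g hg y _ ih => exact hG g hg y ih

lemma mul_mem_of_mem_span {S : Submodule laurentRing Uq} {G : Set Uq} {y : Uq}
    (h : ∀ g ∈ G, y * g ∈ S) {x : Uq} (hx : x ∈ Submodule.span laurentRing G) : y * x ∈ S :=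
  (Submodule.span_le (p := S.comap (LinearMap.mulLeft laurentRing y))).mpr h hx

/-- The `𝒜`-span of the elements `[K; c choose t]` and `K⁻¹ [K; c choose t]`, for fixed `c`. -/
def cartanLattice (c : ℤ) : Submodule laurentRing Uq :=
  Submodule.span laurentRing (Set.range (lusztig c) ∪ Set.range fun t => Kinv * lusztig c t)

lemma lusztig_mem_cartanLattice (c : ℤ) (t : ℕ) : lusztig c t ∈ cartanLattice c :=
  Submodule.subset_span (Or.inl ⟨t, rfl⟩)

lemma Kinv_mul_lusztig_mem_cartanLattice (c : ℤ) (t : ℕ) :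
    Kinv * lusztig c t ∈ cartanLattice c :=
  Submodule.subset_span (Or.inr ⟨t, rfl⟩)

lemma mul_mem_of_mem_cartanLattice {S : Submodule laurentRing Uq} {c : ℤ} {y : Uq}
    (h : ∀ t, y * lusztig c t ∈ S) (h' : ∀ t, y * (Kinv * lusztig c t) ∈ S) {x : Uq}
    (hx : x ∈ cartanLattice c) : y * x ∈ S := by
  refine mul_mem_of_mem_span ?_ hx
  rintro _ (⟨t, rfl⟩ | ⟨t, rfl⟩)
  exacts [h t, h' t]

lemma cartanLattice_le {S : Submodule laurentRing Uq} {c : ℤ}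
    (h : ∀ t, lusztig c t ∈ S) (h' : ∀ t, Kinv * lusztig c t ∈ S) : cartanLattice c ≤ S := by
  refine Submodule.span_le.mpr ?_
  rintro _ (⟨t, rfl⟩ | ⟨t, rfl⟩)
  exacts [h t, h' t]

lemma K_mul_lusztig_sub (c : ℤ) (t : ℕ) :
    q ^ (c - t) • (K * lusztig c t) - q ^ (t - c) • (Kinv * lusztig c t) =
      (q ^ ((t : ℤ) + 1) - q ^ (-((t : ℤ) + 1))) • lusztig c (t + 1) := by
  have h := congrArg (fun x => (q - q⁻¹) • x) (bracketK_mul_lusztig c t)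
  simp only [bracketK, smul_smul, smul_mul_assoc, sub_mul,
    mul_inv_cancel₀ q_sub_inv_ne_zero, one_smul, mul_comm _ (qIntZ _), qIntZ_mul, neg_sub] at h
  exact h

lemma K_mul_lusztig (c : ℤ) (t : ℕ) : K * lusztig c t =
    q ^ (t - c) • ((q ^ (t - c) • (Kinv * lusztig c t)) +
      (q ^ ((t : ℤ) + 1) - q ^ (-((t : ℤ) + 1))) • lusztig c (t + 1)) := by
  rw [← K_mul_lusztig_sub, add_sub_cancel, smul_smul, ← zpow_add₀ q_ne_zero]
  simp

lemma Kinv_mul_Kinv_mul_lusztig (c : ℤ) (t : ℕ) : Kinv * (Kinv * lusztig c t) =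
    q ^ (c - t) • ((q ^ (c - t) • lusztig c t) -
      (q ^ ((t : ℤ) + 1) - q ^ (-((t : ℤ) + 1))) • (Kinv * lusztig c (t + 1))) := by
  have h := congrArg (fun x => Kinv * x) (K_mul_lusztig_sub c t)
  simp only [mul_sub, mul_smul_comm] at h
  rw [← mul_assoc Kinv K, Kinv_mul_K, one_mul] at h
  rw [← h, sub_sub_cancel, smul_smul, ← zpow_add₀ q_ne_zero]
  simp

lemma Kinv_mul_mem_cartanLattice {c : ℤ} {x : Uq} (hx : x ∈ cartanLattice c) :
    Kinv * x ∈ cartanLattice c := by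
  refine mul_mem_of_mem_cartanLattice (fun t => Kinv_mul_lusztig_mem_cartanLattice c t)
    (fun t => ?_) hx
  rw [Kinv_mul_Kinv_mul_lusztig]
  refine smul_mem_of_mem_laurentRing (q_zpow_mem _) (sub_mem ?_ ?_)
  · exact smul_mem_of_mem_laurentRing (q_zpow_mem _) (lusztig_mem_cartanLattice c t)
  · exact smul_mem_of_mem_laurentRing (sub_mem (q_zpow_mem _) (q_zpow_mem _))
      (Kinv_mul_lusztig_mem_cartanLattice c _)

lemma K_mul_mem_cartanLattice {c : ℤ} {x : Uq} (hx : x ∈ cartanLattice c) :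
    K * x ∈ cartanLattice c := by
  refine mul_mem_of_mem_cartanLattice (fun t => ?_) (fun t => ?_) hx
  · rw [K_mul_lusztig]
    refine smul_mem_of_mem_laurentRing (q_zpow_mem _) (add_mem ?_ ?_)
    · exact smul_mem_of_mem_laurentRing (q_zpow_mem _) (Kinv_mul_lusztig_mem_cartanLattice c t)
    · exact smul_mem_of_mem_laurentRing (sub_mem (q_zpow_mem _) (q_zpow_mem _))
        (lusztig_mem_cartanLattice c _)
  · rw [← mul_assoc, K_mul_Kinv, one_mul]
    exact lusztig_mem_cartanLattice c t

/-- Pascal's rule expresses each `[K; c + 1 choose t]` through the lattice for `c`, and, read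
backwards and by induction on `t`, conversely. -/
lemma cartanLattice_add_one (c : ℤ) : cartanLattice (c + 1) = cartanLattice c := by
  apply le_antisymm
  · have h : ∀ t, lusztig (c + 1) t ∈ cartanLattice c := by
      intro t
      cases t with
      | zero => simpa using lusztig_mem_cartanLattice c 0
      | succ t =>
        rw [lusztig_pascal]
        exact add_mem
          (smul_mem_of_mem_laurentRing (q_zpow_mem _) (lusztig_mem_cartanLattice c _))
          (smul_mem_of_mem_laurentRing (q_zpow_mem _) (Kinv_mul_lusztig_mem_cartanLattice c _))
    exact cartanLattice_le h fun t => Kinv_mul_mem_cartanLattice (h t)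
  · have h : ∀ t, lusztig c t ∈ cartanLattice (c + 1) := by
      intro t
      induction t with
      | zero => simpa using lusztig_mem_cartanLattice (c + 1) 0
      | succ t ih =>
        have e : lusztig c (t + 1) = q ^ (-((t : ℤ) + 1)) •
            (lusztig (c + 1) (t + 1) - q ^ ((t : ℤ) - c) • (Kinv * lusztig c t)) := by
          rw [lusztig_pascal, add_sub_cancel_right, smul_smul, ← zpow_add₀ q_ne_zero]
          simp
        rw [e]
        exact smul_mem_of_mem_laurentRing (q_zpow_mem _)
          (sub_mem (lusztig_mem_cartanLattice _ _)
            (smul_mem_of_mem_laurentRing (q_zpow_mem _) (Kinv_mul_mem_cartanLattice ih)))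
    exact cartanLattice_le h fun t => Kinv_mul_mem_cartanLattice (h t)

lemma cartanLattice_eq (c : ℤ) : cartanLattice c = cartanLattice 0 := by
  induction c using Int.induction_on with
  | zero => rfl
  | succ n ih => rw [cartanLattice_add_one, ih]
  | pred n ih => rw [← ih, ← cartanLattice_add_one (-(n : ℤ) - 1), sub_add_cancel]

lemma lusztig_mul_lusztig (c : ℤ) (t j : ℕ) :
    lusztig c t * lusztig (c - t) j = qBinom t j • lusztig c (t + j) := by
  induction j with
  | zero => simp [qBinom, qFactorial_ne_zero]
  | succ j ih =>
    have h1 : qIntZ ((j : ℤ) + 1) ≠ 0 := qIntZ_ne_zero (by lia)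
    have h2 : qIntZ ((t : ℤ) + j + 1) ≠ 0 := qIntZ_ne_zero (by lia)
    rw [lusztig_succ, mul_smul_comm, ← mul_assoc, ih, ← add_assoc, lusztig_succ,
      smul_mul_assoc, smul_smul, smul_smul, qBinom, qBinom, ← add_assoc t j 1, qFactorial_succ,
      qFactorial_succ]
    push_cast
    rw [show c - t - j = c - (t + j : ℤ) by ring]
    congr 1
    have := qFactorial_ne_zero j
    have := qFactorial_ne_zero t
    field_simp

lemma lusztig_mul_mem_cartanLattice (t : ℕ) {x : Uq} (hx : x ∈ cartanLattice 0) :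
    lusztig 0 t * x ∈ cartanLattice 0 := by
  -- The lattice does not depend on `c`, so `x` is expanded in the elements `[K; -t choose j]`,
  -- whose products with `[K; 0 choose t]` are integral multiples of `[K; 0 choose t + j]`.
  rw [← cartanLattice_eq (0 - t)] at hx
  have h : ∀ j, lusztig 0 t * lusztig (0 - t) j ∈ cartanLattice 0 := fun j => by
    rw [lusztig_mul_lusztig]
    exact smul_mem_of_mem_laurentRing (qBinom_mem t j) (lusztig_mem_cartanLattice 0 _)
  refine mul_mem_of_mem_cartanLattice h (fun j => ?_) hx
  rw [← mul_assoc, ← (commute_lusztig commute_Kinv_bracketK 0 t).eq, mul_assoc]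
  exact Kinv_mul_mem_cartanLattice (h j)

lemma K_mem_integralCartan : K ∈ integralCartan :=
  Algebra.subset_adjoin (Or.inl (Or.inl rfl))

lemma Kinv_mem_integralCartan : Kinv ∈ integralCartan :=
  Algebra.subset_adjoin (Or.inl (Or.inr rfl))

lemma mem_integralCartan_iff {x : Uq} : x ∈ integralCartan ↔ x ∈ cartanLattice 0 := by
  constructor
  · refine mem_of_mem_adjoin_of_mul_mem (by simpa using lusztig_mem_cartanLattice 0 0) ?_
    rintro g ((rfl | rfl) | ⟨t, rfl⟩) x hx
    · exact K_mul_mem_cartanLattice hx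
    · exact Kinv_mul_mem_cartanLattice hx
    · exact lusztig_mul_mem_cartanLattice t hx
  · have h : ∀ t, lusztig 0 t ∈ integralCartan := fun t =>
      Algebra.subset_adjoin (Or.inr ⟨t, rfl⟩)
    exact @cartanLattice_le (Subalgebra.toSubmodule integralCartan) 0 h
      (fun t => integralCartan.mul_mem Kinv_mem_integralCartan (h t)) x

lemma lusztig_mem_integralCartan (c : ℤ) (t : ℕ) : lusztig c t ∈ integralCartan := by
  rw [mem_integralCartan_iff, ← cartanLattice_eq c]
  exact lusztig_mem_cartanLattice c t

lemma zpow_smul_mem_integralCartan (c : ℤ) {x : Uq} (hx : x ∈ integralCartan) :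
    q ^ c • x ∈ integralCartan :=
  smul_mem_of_mem_laurentRing (S := Subalgebra.toSubmodule integralCartan) (q_zpow_mem c) hx

lemma mem_span_of_mem_integralCartan {x : Uq} (hx : x ∈ integralCartan) :
    x ∈ Submodule.span laurentRing
      (Set.range fun i : CartanIndex => lusztig i.1.1 i.1.2) := by
  rw [mem_integralCartan_iff] at hx
  have h : ∀ t, lusztig 0 t ∈ Submodule.span laurentRing
      (Set.range fun i : CartanIndex => lusztig i.1.1 i.1.2) := fun t =>
    Submodule.subset_span ⟨⟨(0, t), Or.inl rfl⟩, rfl⟩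
  refine cartanLattice_le h (fun t => ?_) hx
  have e : Kinv * lusztig 0 t = q ^ (-(t : ℤ)) •
      (lusztig 1 (t + 1) - q ^ ((t : ℤ) + 1) • lusztig 0 (t + 1)) := by
    have := lusztig_pascal 0 t
    rw [zero_add, sub_zero] at this
    rw [this, add_sub_cancel_left, smul_smul, ← zpow_add₀ q_ne_zero]
    simp
  rw [e]
  exact smul_mem_of_mem_laurentRing (q_zpow_mem _)
    (sub_mem (Submodule.subset_span ⟨⟨(1, t + 1), Or.inr ⟨rfl, by simp⟩⟩, rfl⟩)
      (smul_mem_of_mem_laurentRing (q_zpow_mem _) (h _)))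

/-! ### Commuting divided powers of `E` past those of `F` -/

lemma qIntZ_smul_bracketK_add (m n a : ℤ) :
    qIntZ m • bracketK (-m - a) + qIntZ n • bracketK (n - a) =
      qIntZ (m + n) • bracketK (n - m - a) := by
  have e : ∀ x y z w : Qq, x • K - y • Kinv + (z • K - w • Kinv) =
      (x + z) • K - (y + w) • Kinv := fun x y z w => by
    rw [add_smul, add_smul]; abel
  simp only [bracketK, smul_sub, smul_smul, qIntZ]
  rw [e]
  have := q_ne_zero
  have := q_sub_inv_ne_zero
  congr 2
  · simp only [sub_eq_add_neg, neg_add, zpow_add₀ q_ne_zero, zpow_neg]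
    field_simp
    ring
  · simp only [sub_eq_add_neg, neg_add, neg_neg, zpow_add₀ q_ne_zero, zpow_neg]
    field_simp
    ring

lemma E_mul_F_pow (n : ℕ) : E * F ^ (n + 1) =
    F ^ (n + 1) * E + qIntZ (n + 1) • (F ^ n * bracketK (-n)) := by
  induction n with
  | zero => simp [E_mul_F]
  | succ n ih =>
    have h := qIntZ_smul_bracketK_add (n + 1) 1 1
    rw [pow_succ, ← mul_assoc, ih, add_mul, mul_assoc, E_mul_F, smul_mul_assoc, mul_assoc,
      bracketK_mul_of_K_mul K_mul_F, mul_add, ← mul_assoc, ← mul_assoc, ← pow_succ,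
      add_assoc, ← pow_succ, ← mul_smul_comm, ← mul_add, add_comm (bracketK 0),
      ← mul_smul_comm]
    congr 2
    rw [qIntZ_one, one_smul] at h
    push_cast
    convert h using 3 <;> ring_nf

/-- The divided power `E^{(m)}` for an integer `m`, zero when `m < 0`. -/
def dividedEZ (m : ℤ) : Uq := if 0 ≤ m then dividedE m.toNat else 0

/-- The divided power `F^{(m)}` for an integer `m`, zero when `m < 0`. -/
def dividedFZ (m : ℤ) : Uq := if 0 ≤ m then dividedF m.toNat else 0

@[simp] lemma dividedEZ_natCast (n : ℕ) : dividedEZ n = dividedE n := by simp [dividedEZ]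

@[simp] lemma dividedFZ_natCast (n : ℕ) : dividedFZ n = dividedF n := by simp [dividedFZ]

lemma dividedEZ_of_neg {m : ℤ} (hm : m < 0) : dividedEZ m = 0 := by simp [dividedEZ, hm]

lemma dividedFZ_of_neg {m : ℤ} (hm : m < 0) : dividedFZ m = 0 := by simp [dividedFZ, hm]

@[simp] lemma dividedE_zero : dividedE 0 = 1 := by simp [dividedE]

@[simp] lemma dividedF_zero : dividedF 0 = 1 := by simp [dividedF]

lemma E_mul_dividedEZ (m : ℤ) : E * dividedEZ m = qIntZ (m + 1) • dividedEZ (m + 1) := by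
  rcases lt_or_ge m 0 with hm | hm
  · rw [dividedEZ_of_neg hm, mul_zero]
    rcases eq_or_lt_of_le (Int.add_one_le_iff.mpr hm) with h | h
    · rw [h]; simp
    · rw [dividedEZ_of_neg h, smul_zero]
  · lift m to ℕ using hm
    have h1 : qIntZ ((m : ℤ) + 1) ≠ 0 := qIntZ_ne_zero (by lia)
    rw [← Nat.cast_succ, dividedEZ_natCast, dividedEZ_natCast, dividedE, dividedE, mul_smul_comm,
      ← pow_succ', smul_smul, Nat.succ_eq_add_one, qFactorial_succ]
    congr 1
    push_cast
    field_simp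

lemma E_mul_dividedFZ (m : ℤ) :
    E * dividedFZ m = dividedFZ m * E + dividedFZ (m - 1) * bracketK (1 - m) := by
  rcases lt_or_ge m 0 with hm | hm
  · simp [dividedFZ_of_neg hm, dividedFZ_of_neg (show m - 1 < 0 by lia)]
  · lift m to ℕ using hm
    cases m with
    | zero =>
      rw [dividedFZ_of_neg (show ((0 : ℕ) : ℤ) - 1 < 0 by lia), dividedFZ_natCast]
      simp
    | succ n =>
      have h1 : qIntZ ((n : ℤ) + 1) ≠ 0 := qIntZ_ne_zero (by lia)
      have := qFactorial_ne_zero n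
      rw [show ((n + 1 : ℕ) : ℤ) - 1 = n by simp, show 1 - ((n + 1 : ℕ) : ℤ) = -n by simp,
        dividedFZ_natCast, dividedFZ_natCast, dividedF, dividedF, mul_smul_comm, E_mul_F_pow,
        smul_add, smul_smul, smul_mul_assoc, smul_mul_assoc, qFactorial_succ]
      congr 2
      field_simp

lemma E_mul_lusztig (c : ℤ) (t : ℕ) : E * lusztig c t = lusztig (c - 2) t * E := by
  rw [lusztig_mul_of_K_mul K_mul_E, sub_add_cancel]

/-- Kac's formula for the product `E^{(n)} F^{(a)}`. With divided powers indexed by integers, the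
terms with `t > a` vanish by themselves. -/
lemma dividedE_mul_dividedFZ (n : ℕ) (a : ℤ) : dividedE n * dividedFZ a =
    ∑ t ∈ Finset.range (n + 1),
      dividedFZ (a - t) * lusztig (2 * t - n - a) t * dividedEZ (n - t) := by
  induction n with
  | zero => simp [dividedEZ]
  | succ n ih =>
    have h0 : qIntZ ((n : ℤ) + 1) ≠ 0 := qIntZ_ne_zero (by lia)
    have hE : E * dividedE n = qIntZ (n + 1) • dividedE (n + 1) := by
      have := E_mul_dividedEZ n
      rwa [← Nat.cast_succ, dividedEZ_natCast, dividedEZ_natCast, Nat.cast_succ] at this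
    -- Multiplying the formula for `n` by `E` and moving `E` to the right turns the summand with
    -- index `t` into `A t + B t`, and `C` is the sequence of summands sought; the identity
    -- `C (t + 1) = A (t + 1) + B t` matches the terms that share the same powers of `F` and `E`.
    set A : ℕ → Uq := fun t => qIntZ (n + 1 - t) •
      (dividedFZ (a - t) * lusztig (2 * t - n - a - 2) t * dividedEZ (n + 1 - t)) with hA
    set B : ℕ → Uq := fun t =>
      dividedFZ (a - (t + 1)) * (bracketK (t + 1 - a) * lusztig (2 * t - n - a) t) *
        dividedEZ (n - t) with hB
    set C : ℕ → Uq := fun t => qIntZ (n + 1) •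
      (dividedFZ (a - t) * lusztig (2 * t - (n + 1) - a) t * dividedEZ (n + 1 - t)) with hC
    have hstep : ∀ t : ℕ,
        E * (dividedFZ (a - t) * lusztig (2 * t - n - a) t * dividedEZ (n - t)) =
          A t + B t := by
      intro t
      rw [mul_assoc, ← mul_assoc E, E_mul_dividedFZ, add_mul, mul_assoc _ E, ← mul_assoc E,
        E_mul_lusztig, mul_assoc _ E, E_mul_dividedEZ, show (n : ℤ) - t + 1 = n + 1 - t by ring,
        show a - (t : ℤ) - 1 = a - (t + 1) by ring, show 1 - (a - (t : ℤ)) = t + 1 - a by ring]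
      simp only [hA, hB, mul_smul_comm, mul_assoc]
    have hC0 : C 0 = A 0 := by simp [hA, hC, sub_right_comm]
    have hCs : ∀ t, C (t + 1) = A (t + 1) + B t := by
      intro t
      have ht : qIntZ ((t : ℤ) + 1) ≠ 0 := qIntZ_ne_zero (by lia)
      have key := qIntZ_smul_bracketK_add (n - t) (t + 1) a
      have e1 : lusztig (2 * t - n - a + 1) (t + 1) = (qIntZ (t + 1))⁻¹ •
          (bracketK (2 * t - n - a + 1) * lusztig (2 * t - n - a) t) := lusztig_succ' _ _
      have e2 : lusztig (2 * t - n - a) (t + 1) = (qIntZ (t + 1))⁻¹ •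
          (bracketK (t - n - a) * lusztig (2 * t - n - a) t) := by
        rw [lusztig_succ, (commute_lusztig (commute_bracketK _) _ _).eq]
        congr 3; ring
      have e3 : qIntZ (n + 1) • lusztig (2 * t - n - a + 1) (t + 1) =
          qIntZ (n - t) • lusztig (2 * t - n - a) (t + 1) +
            bracketK (t + 1 - a) * lusztig (2 * t - n - a) t := by
        rw [e1, e2, smul_comm, smul_comm (qIntZ (n - t)), ← smul_mul_assoc, ← smul_mul_assoc,
          show (n : ℤ) + 1 = n - t + (t + 1) by ring,
          show 2 * (t : ℤ) - n - a + 1 = t + 1 - (n - t) - a by ring, ← key, smul_add, add_mul,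
          show (t : ℤ) - n - a = -(n - t) - a by ring]
        simp only [smul_mul_assoc]
        rw [smul_smul _ (qIntZ ((t : ℤ) + 1)),
          inv_mul_cancel₀ ht, one_smul]
      simp only [hA, hB, hC]
      push_cast
      rw [show 2 * ((t : ℤ) + 1) - (n + 1) - a = 2 * t - n - a + 1 by ring,
        show 2 * ((t : ℤ) + 1) - n - a - 2 = 2 * t - n - a by ring,
        show (n : ℤ) + 1 - (t + 1) = n - t by ring, ← smul_mul_assoc, ← mul_smul_comm, e3,
        mul_add, add_mul, mul_smul_comm, smul_mul_assoc]
    have hAn : A (n + 1) = 0 := by simp [hA]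
    have hsum : ∑ t ∈ Finset.range (n + 1 + 1), C t =
        ∑ t ∈ Finset.range (n + 1), (A t + B t) := by
      rw [Finset.sum_range_succ', hC0, Finset.sum_congr rfl fun t _ => hCs t,
        Finset.sum_add_distrib, Finset.sum_add_distrib, add_right_comm,
        ← Finset.sum_range_succ' A, Finset.sum_range_succ A, hAn, add_zero]
    have hmul : qIntZ (n + 1) • (dividedE (n + 1) * dividedFZ a) =
        ∑ t ∈ Finset.range (n + 1 + 1), C t := by
      rw [← smul_mul_assoc, ← hE, mul_assoc, ih, Finset.mul_sum, hsum]
      exact Finset.sum_congr rfl fun t _ => hstep t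
    rw [hC, ← Finset.smul_sum] at hmul
    have := smul_right_injective Uq h0 hmul
    rw [this]
    push_cast
    rfl

/-! ### The triangular decomposition of the integral form -/

lemma dividedE_mul_dividedE (m n : ℕ) :
    dividedE m * dividedE n = qBinom m n • dividedE (m + n) := by
  have := qFactorial_ne_zero (m + n)
  rw [dividedE, dividedE, dividedE, smul_mul_smul_comm, ← pow_add, smul_smul, qBinom]
  congr 1
  field_simp

lemma dividedF_mul_dividedF (m n : ℕ) :
    dividedF m * dividedF n = qBinom m n • dividedF (m + n) := by
  have := qFactorial_ne_zero (m + n)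
  rw [dividedF, dividedF, dividedF, smul_mul_smul_comm, ← pow_add, smul_smul, qBinom]
  congr 1
  field_simp

lemma K_mul_dividedE (n : ℕ) : K * dividedE n = q ^ (2 * n : ℤ) • (dividedE n * K) := by
  rw [dividedE, mul_smul_comm, K_mul_pow_of_K_mul K_mul_E, smul_mul_assoc, smul_comm]

lemma K_mul_dividedF (n : ℕ) : K * dividedF n = q ^ (-2 * n : ℤ) • (dividedF n * K) := by
  rw [dividedF, mul_smul_comm, K_mul_pow_of_K_mul K_mul_F, smul_mul_assoc, smul_comm]

/-- If `K` commutes with `x` up to a power of `q`, then elements of the Cartan part can be moved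
from the right of `x` to the left, at the price of changing them within the Cartan part. -/
lemma exists_mul_eq_mul_of_K_mul {x : Uq} {m : ℤ} (h : K * x = q ^ m • (x * K)) {u : Uq}
    (hu : u ∈ integralCartan) : ∃ v ∈ integralCartan, x * u = v * x := by
  have hq : ∀ (c : ℤ) {y z : Uq}, y = q ^ c • z → z = q ^ (-c) • y := fun c y z e => by
    rw [e, smul_smul, ← zpow_add₀ q_ne_zero, neg_add_cancel, zpow_zero, one_smul]
  induction hu using Algebra.adjoin_induction with
  | mem g hg =>
    rcases hg with (rfl | rfl) | ⟨t, rfl⟩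
    · exact ⟨_, zpow_smul_mem_integralCartan (-m) K_mem_integralCartan,
        by rw [hq m h, smul_mul_assoc]⟩
    · exact ⟨_, zpow_smul_mem_integralCartan (- -m) Kinv_mem_integralCartan,
        by rw [hq (-m) (Kinv_mul_of_K_mul h), smul_mul_assoc]⟩
    · exact ⟨_, lusztig_mem_integralCartan (0 - m) t,
        by rw [lusztig_mul_of_K_mul h, sub_add_cancel]⟩
  | algebraMap r => exact ⟨_, algebraMap_mem _ r, (Algebra.commutes r x).symm⟩
  | add y z _ _ ihy ihz =>
    obtain ⟨v, hv, ev⟩ := ihy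
    obtain ⟨w, hw, ew⟩ := ihz
    exact ⟨_, add_mem hv hw, by rw [mul_add, ev, ew, add_mul]⟩
  | mul y z _ _ ihy ihz =>
    obtain ⟨v, hv, ev⟩ := ihy
    obtain ⟨w, hw, ew⟩ := ihz
    exact ⟨_, mul_mem hv hw, by rw [← mul_assoc, ev, mul_assoc, ew, ← mul_assoc]⟩

/-- The `𝒜`-span of the products `F^{(a)} u E^{(b)}` with `u` in the Cartan part. -/
def triangularLattice : Submodule laurentRing Uq :=
  Submodule.span laurentRing
    {x | ∃ (a b : ℕ), ∃ u ∈ integralCartan, x = dividedF a * u * dividedE b}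

lemma mem_triangularLattice (a b : ℕ) {u : Uq} (hu : u ∈ integralCartan) :
    dividedF a * u * dividedE b ∈ triangularLattice :=
  Submodule.subset_span ⟨a, b, u, hu, rfl⟩

lemma dividedF_mul_mem_triangularLattice (n : ℕ) {x : Uq} (hx : x ∈ triangularLattice) :
    dividedF n * x ∈ triangularLattice := by
  refine mul_mem_of_mem_span ?_ hx
  rintro _ ⟨a, b, u, hu, rfl⟩
  rw [← mul_assoc, ← mul_assoc, dividedF_mul_dividedF, smul_mul_assoc, smul_mul_assoc]
  exact smul_mem_of_mem_laurentRing (qBinom_mem _ _) (mem_triangularLattice _ _ hu)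

lemma mul_dividedE_mem_triangularLattice (n : ℕ) {x : Uq} (hx : x ∈ triangularLattice) :
    x * dividedE n ∈ triangularLattice := by
  refine (Submodule.span_le
    (p := triangularLattice.comap (LinearMap.mulRight laurentRing (dividedE n)))).mpr ?_ hx
  rintro _ ⟨a, b, u, hu, rfl⟩
  change dividedF a * u * dividedE b * dividedE n ∈ triangularLattice
  rw [mul_assoc, dividedE_mul_dividedE, mul_smul_comm]
  exact smul_mem_of_mem_laurentRing (qBinom_mem _ _) (mem_triangularLattice _ _ hu)

lemma dividedE_mul_mem_triangularLattice (n : ℕ) {x : Uq} (hx : x ∈ triangularLattice) :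
    dividedE n * x ∈ triangularLattice := by
  refine mul_mem_of_mem_span ?_ hx
  rintro _ ⟨a, b, u, hu, rfl⟩
  rw [← mul_assoc]
  refine mul_dividedE_mem_triangularLattice b ?_
  rw [← mul_assoc, ← dividedFZ_natCast, dividedE_mul_dividedFZ, Finset.sum_mul]
  refine sum_mem fun t ht => ?_
  have htn : t ≤ n := by simpa [Nat.lt_succ_iff] using ht
  rcases lt_or_ge a t with h | h
  · rw [dividedFZ_of_neg (by lia)]
    simp
  · rw [← Nat.cast_sub h, ← Nat.cast_sub htn, dividedFZ_natCast, dividedEZ_natCast]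
    obtain ⟨v, hv, ev⟩ := exists_mul_eq_mul_of_K_mul (K_mul_dividedE (n - t)) hu
    rw [mul_assoc, ev, ← mul_assoc, mul_assoc (dividedF _)]
    exact mem_triangularLattice _ _ (mul_mem (lusztig_mem_integralCartan _ _) hv)

lemma mul_mem_triangularLattice {y : Uq}
    (h : ∀ a, ∃ v ∈ integralCartan, y * dividedF a = dividedF a * v) {x : Uq}
    (hx : x ∈ triangularLattice) : y * x ∈ triangularLattice := by
  refine mul_mem_of_mem_span ?_ hx
  rintro _ ⟨a, b, u, hu, rfl⟩
  obtain ⟨v, hv, ev⟩ := h a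
  rw [← mul_assoc, ← mul_assoc, ev, mul_assoc (dividedF a)]
  exact mem_triangularLattice _ _ (mul_mem hv hu)

lemma mem_triangularLattice_of_mem_integralForm {x : Uq} (hx : x ∈ integralForm) :
    x ∈ triangularLattice := by
  refine mem_of_mem_adjoin_of_mul_mem ?_ ?_ hx
  · simpa using mem_triangularLattice 0 0 (one_mem integralCartan)
  · rintro g (((⟨n, rfl⟩ | ⟨n, rfl⟩) | (rfl | rfl)) | ⟨t, rfl⟩) x hx
    · exact dividedE_mul_mem_triangularLattice n hx
    · exact dividedF_mul_mem_triangularLattice n hx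
    · exact mul_mem_triangularLattice (fun a =>
        ⟨_, zpow_smul_mem_integralCartan _ K_mem_integralCartan,
        by rw [K_mul_dividedF, mul_smul_comm]⟩) hx
    · exact mul_mem_triangularLattice (fun a =>
        ⟨_, zpow_smul_mem_integralCartan _ Kinv_mem_integralCartan,
        by rw [Kinv_mul_of_K_mul (K_mul_dividedF a), mul_smul_comm]⟩) hx
    · exact mul_mem_triangularLattice (fun a => ⟨_, lusztig_mem_integralCartan _ _,
        lusztig_mul_of_K_mul (K_mul_dividedF a) 0 t⟩) hx

lemma mem_span_of_mem_integralForm {x : Uq} (hx : x ∈ integralForm) :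
    x ∈ Submodule.span laurentRing (Set.range fun i : FullIndex =>
      dividedF i.1.1 * lusztig i.1.2.1 i.1.2.2.1 * dividedE i.1.2.2.2) := by
  refine (Submodule.span_le.mpr ?_) (mem_triangularLattice_of_mem_integralForm hx)
  rintro _ ⟨a, b, u, hu, rfl⟩
  let φ : Uq →ₗ[laurentRing] Uq :=
    LinearMap.mulRight laurentRing (dividedE b) ∘ₗ LinearMap.mulLeft laurentRing (dividedF a)
  suffices h : u ∈ (Submodule.span laurentRing (Set.range fun i : FullIndex =>
      dividedF i.1.1 * lusztig i.1.2.1 i.1.2.2.1 * dividedE i.1.2.2.2)).comap φ from h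
  refine (Submodule.span_le.mpr ?_) (mem_span_of_mem_integralCartan hu)
  rintro _ ⟨⟨⟨c, t⟩, h⟩, rfl⟩
  refine Submodule.subset_span ⟨⟨(a, c, t, b), ?_⟩, rfl⟩
  rcases h with h | ⟨h, ht⟩
  · exact Or.inl h
  · right
    simp only at h ht ⊢
    lia

lemma lusztig_mem_integralForm (c : ℤ) (t : ℕ) : lusztig c t ∈ integralForm := by
  have h : integralCartan ≤ integralForm := by
    refine Algebra.adjoin_mono ?_
    rintro x (hx | hx)
    · exact Or.inl (Or.inr hx)
    · exact Or.inr hx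
  exact h (lusztig_mem_integralCartan c t)

lemma mul_mul_mem_integralForm (a : ℕ) (c : ℤ) (t b : ℕ) :
    dividedF a * lusztig c t * dividedE b ∈ integralForm :=
  mul_mem (mul_mem (Algebra.subset_adjoin (Or.inl (Or.inl (Or.inr ⟨a, rfl⟩))))
    (lusztig_mem_integralForm c t))
    (Algebra.subset_adjoin (Or.inl (Or.inl (Or.inl ⟨b, rfl⟩))))

/-! ### The regular representation in coordinates -/

/-- The space of coefficient functions `(a, b, n) ↦ f a b n`. A finitely supported `f` with
`0 ≤ a, b` stands for the element `∑ f a b n • F^a K^n E^b` of `U_q(sl₂)`; allowing all functions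
on `ℤ³` makes the operators below free of case distinctions. -/
abbrev Coeff : Type := ℤ → ℤ → ℤ → Qq

/-- Left multiplication by `F` in coordinates. -/
def opF : Module.End Qq Coeff where
  toFun f a b n := f (a - 1) b n
  map_add' _ _ := rfl
  map_smul' _ _ := rfl

/-- Left multiplication by `K` in coordinates. -/
def opK : Module.End Qq Coeff where
  toFun f a b n := q ^ (-2 * a) * f a b (n - 1)
  map_add' f g := by funext a b n; simp [mul_add]
  map_smul' c f := by funext a b n; simp [mul_left_comm]

/-- Left multiplication by `K⁻¹` in coordinates. -/
def opKinv : Module.End Qq Coeff where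
  toFun f a b n := q ^ (2 * a) * f a b (n + 1)
  map_add' f g := by funext a b n; simp [mul_add]
  map_smul' c f := by funext a b n; simp [mul_left_comm]

/-- Left multiplication by `E` in coordinates, read off from
`E F^a = F^a E + {a} F^{a-1} [K; 1 - a]`. -/
def opE : Module.End Qq Coeff where
  toFun f a b n := q ^ (-2 * n) * f a (b - 1) n + qIntZ (a + 1) * (q - q⁻¹)⁻¹ *
    (q ^ (-a) * f (a + 1) b (n - 1) - q ^ a * f (a + 1) b (n + 1))
  map_add' f g := by funext a b n; simp only [Pi.add_apply]; ring
  map_smul' c f := by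
    funext a b n; simp only [Pi.smul_apply, smul_eq_mul, RingHom.id_apply]; ring

lemma opF_apply (f : Coeff) (a b n : ℤ) : opF f a b n = f (a - 1) b n := rfl

lemma opK_apply (f : Coeff) (a b n : ℤ) : opK f a b n = q ^ (-2 * a) * f a b (n - 1) := rfl

lemma opKinv_apply (f : Coeff) (a b n : ℤ) : opKinv f a b n = q ^ (2 * a) * f a b (n + 1) := rfl

lemma opE_apply (f : Coeff) (a b n : ℤ) : opE f a b n =
    q ^ (-2 * n) * f a (b - 1) n + qIntZ (a + 1) * (q - q⁻¹)⁻¹ *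
    (q ^ (-a) * f (a + 1) b (n - 1) - q ^ a * f (a + 1) b (n + 1)) := rfl

lemma opK_mul_opKinv : opK * opKinv = 1 := by
  ext1 f; funext a b n
  simp only [Module.End.mul_apply, opK_apply, opKinv_apply, Module.End.one_apply]
  rw [← mul_assoc, ← zpow_add₀ q_ne_zero]
  simp

lemma opKinv_mul_opK : opKinv * opK = 1 := by
  ext1 f; funext a b n
  simp only [Module.End.mul_apply, opK_apply, opKinv_apply, Module.End.one_apply]
  rw [← mul_assoc, ← zpow_add₀ q_ne_zero]
  simp

lemma opK_mul_opE_mul_opKinv : opK * opE * opKinv = q ^ 2 • opE := by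
  ext1 f; funext a b n
  simp only [Module.End.mul_apply, opK_apply, opE_apply, opKinv_apply, LinearMap.smul_apply,
    Pi.smul_apply, smul_eq_mul]
  have := q_ne_zero
  have h : ∀ m : ℤ, q ^ (2 * m) = (q ^ m) ^ 2 := fun m => by
    rw [mul_comm, zpow_mul]; norm_cast
  simp only [mul_add, mul_one, sub_eq_add_neg, neg_mul, zpow_add₀ q_ne_zero, zpow_neg, h,
    zpow_one, neg_add_cancel_right]
  field_simp

lemma opK_mul_opF_mul_opKinv : opK * opF * opKinv = (q ^ 2)⁻¹ • opF := by
  ext1 f; funext a b n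
  simp only [Module.End.mul_apply, opK_apply, opF_apply, opKinv_apply, LinearMap.smul_apply,
    Pi.smul_apply, smul_eq_mul, sub_add_cancel]
  rw [← mul_assoc, ← zpow_add₀ q_ne_zero, show -2 * a + 2 * (a - 1) = -2 by ring]
  norm_cast

lemma opE_mul_opF_sub : opE * opF - opF * opE = (q - q⁻¹)⁻¹ • (opK - opKinv) := by
  ext1 f; funext a b n
  have h1 : qIntZ (a + 1) * q ^ (-a) - qIntZ a * q ^ (-(a - 1)) = q ^ (-2 * a) := by
    rw [qIntZ_add, qIntZ_one, show -(a - 1) = 1 + -a by ring, show -2 * a = -a + -a by ring,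
      zpow_add₀ q_ne_zero, zpow_add₀ q_ne_zero]
    ring
  have h2 : qIntZ (a + 1) * q ^ a - qIntZ a * q ^ (a - 1) = q ^ (2 * a) := by
    rw [add_comm, qIntZ_add, qIntZ_one, show a - 1 = -1 + a by ring, show 2 * a = a + a by ring,
      zpow_add₀ q_ne_zero, zpow_add₀ q_ne_zero]
    ring
  simp only [LinearMap.sub_apply, Module.End.mul_apply, opK_apply, opF_apply, opE_apply,
    opKinv_apply, LinearMap.smul_apply, Pi.smul_apply, Pi.sub_apply, smul_eq_mul, sub_add_cancel,
    add_sub_cancel_right]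
  rw [← h1, ← h2]
  ring

/-- The operator by which a generator acts. -/
def opGen : Gen → Module.End Qq Coeff
  | .E => opE
  | .F => opF
  | .K => opK
  | .Kinv => opKinv

/-- The regular representation of `U_q(sl₂)` in coordinates. -/
def rep : Uq →ₐ[Qq] Module.End Qq Coeff :=
  RingQuot.liftAlgHom Qq ⟨FreeAlgebra.lift Qq opGen, by
    intro x y h
    cases h
    · simpa [opGen] using opK_mul_opKinv
    · simpa [opGen] using opKinv_mul_opK
    · simpa [opGen] using opK_mul_opE_mul_opKinv
    · simpa [opGen] using opK_mul_opF_mul_opKinv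
    · simpa [opGen] using opE_mul_opF_sub⟩

lemma rep_mk_gen (x : Gen) : rep (mk (gen x)) = opGen x :=
  (RingQuot.liftAlgHom_mkAlgHom_apply Qq _ _ (gen x)).trans (FreeAlgebra.lift_ι_apply _ _)

lemma rep_E : rep E = opE := rep_mk_gen .E

lemma rep_F : rep F = opF := rep_mk_gen .F

lemma rep_K : rep K = opK := rep_mk_gen .K

lemma rep_Kinv : rep Kinv = opKinv := rep_mk_gen .Kinv

/-- The coordinates of `F^a u E^b`, where `w` lists the coefficients of a Laurent polynomial `u`
in `K`. -/
def slice (a b : ℤ) (w : ℤ → Qq) : Coeff := fun a' b' n => if a' = a ∧ b' = b then w n else 0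

lemma smul_slice (r : Qq) (a b : ℤ) (w : ℤ → Qq) : r • slice a b w = slice a b (r • w) := by
  funext a' b' n
  simp [slice]

lemma opF_pow_slice (m : ℕ) (a b : ℤ) (w : ℤ → Qq) :
    (opF ^ m) (slice a b w) = slice (a + m) b w := by
  induction m with
  | zero => simp
  | succ m ih =>
    rw [pow_succ', Module.End.mul_apply, ih]
    funext a' b' n
    have : a' - 1 = a + m ↔ a' = a + (m + 1 : ℕ) := by push_cast; lia
    simp only [opF_apply, slice, this]

lemma opE_pow_slice (m : ℕ) : (opE ^ m) (slice 0 0 (Pi.single 0 1)) =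
    slice 0 m (Pi.single 0 1) := by
  induction m with
  | zero => simp
  | succ m ih =>
    rw [pow_succ', Module.End.mul_apply, ih]
    funext a' b' n
    have hb : b' - 1 = m ↔ b' = (m + 1 : ℕ) := by push_cast; lia
    simp only [opE_apply, slice, hb]
    -- The second part of `opE` only sees `a' = -1`, where its coefficient `{a' + 1}` is zero.
    by_cases ha : a' + 1 = 0
    · rw [ha]
      simp [show a' ≠ 0 by lia]
    · by_cases hn : n = 0 <;> simp [ha, hn]

/-- The action of `[K; c]` on the coefficients of a Laurent polynomial in `K`. -/
def bracketCoeff (c : ℤ) (w : ℤ → Qq) : ℤ → Qq := fun n =>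
  (q - q⁻¹)⁻¹ * (q ^ c * w (n - 1) - q ^ (-c) * w (n + 1))

/-- The coefficients of `[K; c choose t]` as a Laurent polynomial in `K`. -/
def lusztigCoeff (c : ℤ) : ℕ → ℤ → Qq
  | 0 => Pi.single 0 1
  | t + 1 => (qIntZ (t + 1))⁻¹ • bracketCoeff (c - t) (lusztigCoeff c t)

lemma rep_bracketK_slice (c b : ℤ) (w : ℤ → Qq) :
    rep (bracketK c) (slice 0 b w) = slice 0 b (bracketCoeff c w) := by
  funext a' b' n
  simp only [bracketK, map_smul, map_sub, rep_K, rep_Kinv, LinearMap.smul_apply,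
    LinearMap.sub_apply, Pi.smul_apply, Pi.sub_apply, opK_apply, opKinv_apply, slice, smul_eq_mul]
  split_ifs with h
  · simp [h.1, bracketCoeff]
  · simp

lemma rep_lusztig_slice (c b : ℤ) (t : ℕ) :
    rep (lusztig c t) (slice 0 b (Pi.single 0 1)) = slice 0 b (lusztigCoeff c t) := by
  induction t with
  | zero => simp [lusztigCoeff]
  | succ t ih =>
    rw [lusztig_succ, ← (commute_lusztig (commute_bracketK _) c t).eq, map_smul, map_mul,
      LinearMap.smul_apply, Module.End.mul_apply, ih, rep_bracketK_slice, smul_slice,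
      lusztigCoeff]

lemma rep_mul_mul_apply (a : ℕ) (c : ℤ) (t b : ℕ) :
    rep (dividedF a * lusztig c t * dividedE b) (slice 0 0 (Pi.single 0 1)) =
      ((qFactorial b)⁻¹ * (qFactorial a)⁻¹) • slice a b (lusztigCoeff c t) := by
  simp only [dividedE, dividedF, map_mul, map_smul, map_pow, rep_E, rep_F, Module.End.mul_apply,
    LinearMap.smul_apply, opE_pow_slice, rep_lusztig_slice, opF_pow_slice, smul_smul, zero_add]

/-! ### Linear independence -/

/-- `[K; c choose t]` only involves the powers `K^n` with `-t ≤ n ≤ t`. -/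
lemma lusztigCoeff_eq_zero (c : ℤ) {t : ℕ} {n : ℤ} (h : n < -t ∨ t < n) :
    lusztigCoeff c t n = 0 := by
  induction t generalizing n with
  | zero => simp [lusztigCoeff, show n ≠ 0 by lia]
  | succ t ih =>
    push_cast at h
    rw [lusztigCoeff, Pi.smul_apply, bracketCoeff, ih (by lia), ih (by lia)]
    simp

lemma lusztigCoeff_succ_top (c : ℤ) (t : ℕ) : lusztigCoeff c (t + 1) (t + 1 : ℕ) =
    (qIntZ (t + 1))⁻¹ * ((q - q⁻¹)⁻¹ * (q ^ (c - t) * lusztigCoeff c t t)) := by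
  rw [lusztigCoeff, Pi.smul_apply, bracketCoeff, lusztigCoeff_eq_zero c (n := _ + 1) (by lia)]
  simp

lemma lusztigCoeff_succ_bot (c : ℤ) (t : ℕ) : lusztigCoeff c (t + 1) (-(t + 1 : ℕ)) =
    -((qIntZ (t + 1))⁻¹ * ((q - q⁻¹)⁻¹ * (q ^ (t - c) * lusztigCoeff c t (-t)))) := by
  rw [lusztigCoeff, Pi.smul_apply, bracketCoeff, lusztigCoeff_eq_zero c (n := _ - 1) (by lia),
    show -((t + 1 : ℕ) : ℤ) + 1 = -t by lia]
  simp

lemma lusztigCoeff_top (c : ℤ) (t : ℕ) :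
    lusztigCoeff c t t = q ^ (c * t) * lusztigCoeff 0 t t := by
  induction t with
  | zero => simp [lusztigCoeff]
  | succ t ih =>
    rw [lusztigCoeff_succ_top, lusztigCoeff_succ_top, ih, sub_eq_add_neg c,
      zpow_add₀ q_ne_zero, zero_sub, Nat.cast_succ, mul_add, mul_one, zpow_add₀ q_ne_zero]
    ring

lemma lusztigCoeff_bot (c : ℤ) (t : ℕ) :
    lusztigCoeff c t (-t) = q ^ (-(c * t)) * lusztigCoeff 0 t (-t) := by
  induction t with
  | zero => simp [lusztigCoeff]
  | succ t ih =>
    rw [lusztigCoeff_succ_bot, lusztigCoeff_succ_bot, ih, sub_eq_add_neg _ c,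
      zpow_add₀ q_ne_zero, sub_zero, Nat.cast_succ, mul_add, mul_one, neg_add,
      zpow_add₀ q_ne_zero]
    ring

lemma lusztigCoeff_zero_top_ne_zero (t : ℕ) : lusztigCoeff 0 t t ≠ 0 := by
  induction t with
  | zero => simp [lusztigCoeff]
  | succ t ih =>
    rw [lusztigCoeff_succ_top]
    exact mul_ne_zero (inv_ne_zero (qIntZ_ne_zero (by lia)))
      (mul_ne_zero (inv_ne_zero q_sub_inv_ne_zero) (mul_ne_zero (zpow_ne_zero _ q_ne_zero) ih))

lemma lusztigCoeff_zero_bot_ne_zero (t : ℕ) : lusztigCoeff 0 t (-t) ≠ 0 := by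
  induction t with
  | zero => simp [lusztigCoeff]
  | succ t ih =>
    rw [lusztigCoeff_succ_bot]
    exact neg_ne_zero.mpr (mul_ne_zero (inv_ne_zero (qIntZ_ne_zero (by lia)))
      (mul_ne_zero (inv_ne_zero q_sub_inv_ne_zero) (mul_ne_zero (zpow_ne_zero _ q_ne_zero) ih)))

/-- A family is linearly independent if for each index some functional is nonzero at that member
and vanishes at all other members of at most the same rank. -/
lemma linearIndependent_of_rank {k V ι : Type*} [Field k] [AddCommGroup V] [Module k V]
    (v : ι → V) (r : ι → ℕ) (ψ : ι → V →ₗ[k] k) (h1 : ∀ i, ψ i (v i) ≠ 0)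
    (h2 : ∀ i j, j ≠ i → r j ≤ r i → ψ i (v j) = 0) : LinearIndependent k v := by
  rw [linearIndependent_iff]
  intro l hl
  by_contra hne
  obtain ⟨i, hi, hmax⟩ := Finset.exists_max_image l.support r (Finsupp.support_nonempty_iff.mpr hne)
  have h := congrArg (ψ i) hl
  rw [Finsupp.linearCombination_apply, Finsupp.sum, map_sum, map_zero,
    Finset.sum_eq_single i] at h
  · rw [map_smul, smul_eq_mul] at h
    exact (mul_ne_zero (Finsupp.mem_support_iff.mp hi) (h1 i)) h
  · intro j hj hji
    rw [map_smul, h2 i j hji (hmax j hj), smul_zero]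
  · exact fun h' => absurd hi h'

/-- The coefficient of `F^a K^n E^b` in the expansion of an element of `U_q(sl₂)`. -/
def coeffMap (a b n : ℤ) : Uq →ₗ[Qq] Qq where
  toFun x := rep x (slice 0 0 (Pi.single 0 1)) a b n
  map_add' x y := by simp
  map_smul' r x := by simp

lemma coeffMap_apply (a' b' n : ℤ) (a : ℕ) (c : ℤ) (t b : ℕ) :
    coeffMap a' b' n (dividedF a * lusztig c t * dividedE b) =
      (qFactorial b)⁻¹ * (qFactorial a)⁻¹ *
        (if a' = a ∧ b' = b then lusztigCoeff c t n else 0) := by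
  change rep _ _ a' b' n = _
  rw [rep_mul_mul_apply]
  rfl

lemma linearIndependent_fullIndex : LinearIndependent Qq fun i : FullIndex =>
    dividedF i.1.1 * lusztig i.1.2.1 i.1.2.2.1 * dividedE i.1.2.2.2 := by
  -- For `t ≥ 1`, the elements `[K; 0 choose t]` and `[K; 1 choose t]` are told apart by the
  -- combination of the coefficients at `K^t` and `K^{-t}` that kills the other one of the two.
  refine linearIndependent_of_rank _ (fun i => i.1.2.2.1)
    (fun i => if i.1.2.2.1 = 0 then coeffMap i.1.1 i.1.2.2.2 0 else
      lusztigCoeff (1 - i.1.2.1) i.1.2.2.1 (-i.1.2.2.1) • coeffMap i.1.1 i.1.2.2.2 i.1.2.2.1 -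
      lusztigCoeff (1 - i.1.2.1) i.1.2.2.1 i.1.2.2.1 • coeffMap i.1.1 i.1.2.2.2 (-i.1.2.2.1))
    ?_ ?_
  · rintro ⟨⟨a, c, t, b⟩, h⟩
    have ha := qFactorial_ne_zero a
    have hb := qFactorial_ne_zero b
    dsimp only
    split_ifs with ht
    · subst ht
      rw [coeffMap_apply]
      simp [lusztigCoeff, ha, hb]
    · rw [LinearMap.sub_apply, LinearMap.smul_apply, LinearMap.smul_apply, coeffMap_apply,
        coeffMap_apply, lusztigCoeff_top (1 - c), lusztigCoeff_bot (1 - c), lusztigCoeff_top c,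
        lusztigCoeff_bot c]
      have hm : (2 * c - 1) * (t : ℤ) ≠ 0 := mul_ne_zero (by lia) (by simpa using ht)
      have key := mul_ne_zero (mul_ne_zero (mul_ne_zero (inv_ne_zero hb) (inv_ne_zero ha))
        (mul_ne_zero (lusztigCoeff_zero_top_ne_zero t) (lusztigCoeff_zero_bot_ne_zero t)))
        (q_zpow_sub_zpow_neg_ne_zero hm)
      convert key using 1
      rw [show (2 * c - 1) * (t : ℤ) = -((1 - c) * t) + c * t by ring, neg_add, neg_neg,
        zpow_add₀ q_ne_zero, zpow_add₀ q_ne_zero]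
      simp only [true_and, if_true, smul_eq_mul]
      ring
  · rintro ⟨⟨a, c, t, b⟩, h⟩ ⟨⟨a', c', t', b'⟩, h'⟩ hne hle
    dsimp only at h h' hle ⊢
    have hne' : ¬ (a' = a ∧ c' = c ∧ t' = t ∧ b' = b) := by
      rintro ⟨rfl, rfl, rfl, rfl⟩; exact hne rfl
    by_cases hab : a = a' ∧ b = b'
    · obtain ⟨rfl, rfl⟩ := hab
      split_ifs with ht
      · exact absurd ⟨rfl, by lia, by lia, rfl⟩ hne'
      · rw [LinearMap.sub_apply, LinearMap.smul_apply, LinearMap.smul_apply, coeffMap_apply,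
          coeffMap_apply]
        rcases hle.lt_or_eq with hlt | rfl
        · rw [lusztigCoeff_eq_zero c' (n := t) (by lia),
            lusztigCoeff_eq_zero c' (n := -t) (by lia)]
          simp
        · rw [show 1 - c = c' by lia]
          simp only [true_and, if_true, smul_eq_mul]
          ring
    · have hab' : ¬ ((a : ℤ) = a' ∧ (b : ℤ) = b') := by exact_mod_cast hab
      split_ifs with ht
      · rw [coeffMap_apply, if_neg hab', mul_zero]
      · rw [LinearMap.sub_apply, LinearMap.smul_apply, LinearMap.smul_apply, coeffMap_apply,
          coeffMap_apply, if_neg hab', if_neg hab']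
        simp

lemma linearIndependent_cartanIndex : LinearIndependent Qq fun i : CartanIndex =>
    lusztig i.1.1 i.1.2 := by
  let φ : CartanIndex → FullIndex := fun i =>
    ⟨(0, i.1.1, i.1.2, 0), i.2.imp id fun h => by dsimp only; lia⟩
  have hφ : Function.Injective φ := by
    rintro ⟨⟨c, t⟩, h⟩ ⟨⟨c', t'⟩, h'⟩ e
    simpa [φ] using e
  simpa [Function.comp_def, φ] using linearIndependent_fullIndex.comp φ hφ

/-- A family in an `𝒜`-subalgebra that spans it over `𝒜` and is linearly independent over `ℚ(q)`
is an `𝒜`-basis of the subalgebra. -/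
lemma exists_basis {ι : Type*} (S : Subalgebra laurentRing Uq) (v : ι → Uq)
    (hli : LinearIndependent Qq v) (hv : ∀ i, v i ∈ S)
    (hspan : ∀ x ∈ S, x ∈ Submodule.span laurentRing (Set.range v)) :
    ∃ B : Module.Basis ι laurentRing S, ∀ i, (B i : Uq) = v i := by
  have hli' : LinearIndependent laurentRing v := by
    refine hli.restrict_scalars fun x y h => Subtype.ext ?_
    simpa [Algebra.smul_def] using h
  have e : Submodule.span laurentRing (Set.range v) = Subalgebra.toSubmodule S := by
    refine le_antisymm (Submodule.span_le.mpr ?_) hspan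
    rintro _ ⟨i, rfl⟩
    exact hv i
  refine ⟨(Module.Basis.span hli').map (LinearEquiv.ofEq _ _ e), fun i => ?_⟩
  rw [Module.Basis.map_apply]
  exact congrArg Subtype.val (Module.Basis.span_apply hli' i)

end QuantumSl2

end

theorem proposition4 :
    (∃ B : Module.Basis QuantumSl2.CartanIndex QuantumSl2.laurentRing QuantumSl2.integralCartan,
      ∀ (c : ℤ) (t : ℕ) (h : c = 0 ∨ (c = 1 ∧ 1 ≤ t)),
        (B ⟨(c, t), h⟩ : QuantumSl2.Uq) = QuantumSl2.lusztig c t) ∧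
    (∃ B : Module.Basis QuantumSl2.FullIndex QuantumSl2.laurentRing QuantumSl2.integralForm,
      ∀ (a : ℕ) (c : ℤ) (t b : ℕ) (h : c = 0 ∨ c = min 1 (t : ℤ)),
        (B ⟨(a, c, t, b), h⟩ : QuantumSl2.Uq) =
          QuantumSl2.dividedF a * QuantumSl2.lusztig c t * QuantumSl2.dividedE b) := by
  constructor
  · obtain ⟨B, hB⟩ := QuantumSl2.exists_basis QuantumSl2.integralCartan _
      QuantumSl2.linearIndependent_cartanIndex
      (fun i => QuantumSl2.lusztig_mem_integralCartan _ _)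
      (fun _ => QuantumSl2.mem_span_of_mem_integralCartan)
    exact ⟨B, fun c t h => hB ⟨(c, t), h⟩⟩
  · obtain ⟨B, hB⟩ := QuantumSl2.exists_basis QuantumSl2.integralForm _
      QuantumSl2.linearIndependent_fullIndex
      (fun i => QuantumSl2.mul_mul_mem_integralForm _ _ _ _)
      (fun _ => QuantumSl2.mem_span_of_mem_integralForm)
    exact ⟨B, fun a c t b h => hB ⟨(a, c, t, b), h⟩⟩
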